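/- All logarithms are to base $2$. A (discrete memoryless) classical–quantum channel $W$ with input alphabet $\mathcal X$, a nonempty finite set of size $a$, and output dimension $d$ is a map $x\mapsto W_x$ from $\mathcal X$ to the density operators (positive semidefinite operators of trace one) on a complex Hilbert space $\mathcal H$ of dimension $d$. For a probability distribution $P$ on $\mathcal X$ put $PW=\sum_x P(x)W_x$ and $$I(P;W)=H(PW)-\sum_{x\in\mathcal X}P(x)H(W_x),$$ where $H(\rho)=-\operatorname{Tr}(\rho\log\rho)$ is the von Neumann entropy, and let $C(W)=\max_P I(P;W)$, the maximum over all probability distributions on $\mathcal X$. For $n\ge 1$, an $n$-block code is a pair $(f,D)$ consisting of a map $f:\mathcal M\to\mathcal X^n$ on a finite set $\mathcal M$ and a family $D=(D_m)_{m\in\mathcal M'}$ of positive semidefinite operators on $\mathcal H^{\otimes n}$ with $\sum_{m\in\mathcal M'}D_m=\mathbf 1$, indexed by a finite set $\mathcal M'\supseteq\mathcal M$. It is an $(n,\lambda)$-code if $1-\operatorname{Tr}\big((W_{x_1}\otimes\cdots\otimes W_{x_n})D_m\big)\le\lambda$ for every $m\in\mathcal M$, where $x_1\ldots x_n=f(m)$.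 Let $N(n,\lambda)$ be the maximum of $|\mathcal M|$ over all $(n,\lambda)$-codes for $W$. **Theorem.** For every $\lambda\in(0,1)$ and all $a,d\in\mathbb N$ there is a constant $K=K(\lambda,a,d)$ such that, for every classical–quantum channel $W$ with input alphabet of size $a$ and output dimension $d$, the maxima defining $C(W)$ and $N(n,\lambda)$ (for every $n\ge1$) are attained, and for every $n\ge 1$ $$\big|\log N(n,\lambda)-n\,C(W)\big|\le K\sqrt n .$$ -/

import Mathlib

noncomputable section

namespace CQ

open scoped ComplexOrder

/-- A state (density operator) on the Hilbert space `ℂ^ι`: a positive semidefinite operator,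
written as a matrix in an orthonormal basis, of trace one. -/
structure State (ι : Type*) [Fintype ι] where
  mat : Matrix ι ι ℂ
  posSemidef : mat.PosSemidef
  trace_eq_one : mat.trace = 1

/-- A (discrete memoryless) classical-quantum channel with input alphabet `X` and output
system `L(ℂ^ι)`: a map from `X` to states. -/
abbrev Channel (X ι : Type*) [Fintype ι] := X → State ι

variable {X ι : Type*} [Fintype X] [Fintype ι] [DecidableEq ι]

/-- The von Neumann entropy, in bits: the Shannon entropy `-∑ R(j) log₂ R(j)` of the list of
eigenvalues (with `0 log 0 = 0`). -/
def entropy (ρ : State ι) : ℝ :=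
  -∑ j, ρ.posSemidef.isHermitian.eigenvalues j *
    Real.logb 2 (ρ.posSemidef.isHermitian.eigenvalues j)

/-- The average output state `PW = ∑ x, P(x) W_x`. -/
def avgState (P : stdSimplex ℝ X) (W : Channel X ι) : State ι where
  mat := ∑ x, ((P x : ℝ) : ℂ) • (W x).mat
  posSemidef := Matrix.posSemidef_sum _ fun x _ =>
    (W x).posSemidef.smul (by exact_mod_cast P.2.1 x)
  trace_eq_one := by
    rw [Matrix.trace_sum]
    simp only [Matrix.trace_smul, (W _).trace_eq_one, smul_eq_mul, mul_one]
    exact_mod_cast P.2.2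

/-- The conditional entropy `H(W|P) = ∑ x, P(x) H(W_x)`. -/
def condEntropy (P : stdSimplex ℝ X) (W : Channel X ι) : ℝ :=
  ∑ x, (P x : ℝ) * entropy (W x)

/-- The mutual (Holevo) information `I(P;W) = H(PW) - H(W|P)`. -/
def mutualInfo (P : stdSimplex ℝ X) (W : Channel X ι) : ℝ :=
  entropy (avgState P W) - condEntropy P W

/-- `C(W) = max_P I(P;W)`, the maximum over all probability distributions `P` on `X`. -/
def capacity (W : Channel X ι) : ℝ :=
  sSup (Set.range fun P : stdSimplex ℝ X => mutualInfo P W)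

/-- The matrix of `W_{x₁} ⊗ ⋯ ⊗ W_{xₙ}` on `(ℂ^ι)^{⊗ n}`, in the product basis, which is
indexed by `Fin n → ι`. -/
def outputMat (W : Channel X ι) {n : ℕ} (x : Fin n → X) :
    Matrix (Fin n → ι) (Fin n → ι) ℂ :=
  Matrix.of fun i j => ∏ k, (W (x k)).mat (i k) (j k)

/-- An `n`-block code: an observable `D` on `L(ℂ^ι)^{⊗ n}` (a partition of the identity into
positive operators) indexed by a finite set `Outcome`, a set of messages contained in `Outcome`,
and an encoding of the messages by words of length `n` over `X`. -/
structure BlockCode (X ι : Type*) [Fintype ι] [DecidableEq ι] (n : ℕ) where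
  Outcome : Type
  [fintypeOutcome : Fintype Outcome]
  D : Outcome → Matrix (Fin n → ι) (Fin n → ι) ℂ
  D_posSemidef : ∀ m, (D m).PosSemidef
  D_sum : ∑ m, D m = 1
  messages : Finset Outcome
  encode : messages → (Fin n → X)

/-- The number of messages of a code. -/
def BlockCode.size {n : ℕ} (c : BlockCode X ι n) : ℕ := c.messages.card

/-- The maximum error probability `max {1 - Tr(W_{f(m)} D_m) : m a message}` (zero if there are
no messages). The trace is a real number. -/
def BlockCode.errorProb {n : ℕ} (c : BlockCode X ι n) (W : Channel X ι) : ℝ :=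
  ⨆ m : c.messages, (1 - (Matrix.trace (outputMat W (c.encode m) * c.D m)).re)

/-- The set of sizes of `(n, lam)`-codes for `W`, i.e. of `n`-block codes with maximum error
probability at most `lam`. -/
def codeSizes (W : Channel X ι) (n : ℕ) (lam : ℝ) : Set ℕ :=
  {N | ∃ c : BlockCode X ι n, c.errorProb W ≤ lam ∧ c.size = N}

/-- `N(n, lam)`: the maximum size of an `(n, lam)`-code for `W`. -/
def maxCodeSize (W : Channel X ι) (n : ℕ) (lam : ℝ) : ℕ :=
  sSup (codeSizes W n lam)

end CQ

end

/-!
Write `n` for the block length, `δ = κ √n`, and fix an input distribution `P` with average output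
state `σ = PW`. The proof compares dimensions of typical subspaces, using nothing about
fluctuations beyond Chebyshev's inequality; this is why the error term is of order `√n` and
uniform in the channel.

*Typical subspaces.* In an eigenbasis of a product state `σ₁ ⊗ ⋯ ⊗ σₙ` the logarithm of the
eigenvalue is a sum of independent terms, with second moments bounded because `p (log p)²` is
bounded on `[0, 1]`. Hence all but a small part of the state lives on the span of the eigenvectors
with eigenvalue `2 ^ (-∑ H(σₖ) ± δ)` (`CQ.typProj`), a space of dimension at most
`2 ^ (∑ H(σₖ) + δ)`. See `CQ.typical_prod`, `CQ.trace_typProj_le` and `CQ.tracePair_tens_le`.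
In place of the gentle measurement lemma stands the inequality
`D ≤ (1 + t) ADA + (1 + t⁻¹) (1 - A) D (1 - A)` (`CQ.posSemidef_pinching`).

*Strong converse.* Split a code into subcodes with codewords of constant type; there are at most
`(n + 1) ^ |X|` of them. If all codewords have type `P`, their outputs are nearly supported on
the typical subspace of `σ ⊗ ⋯ ⊗ σ`, although they do not commute with it: the relevant moments
are averages over the letters of a word, and these averages reproduce `σ`
(`CQ.HasType.tracePair_one_sub_typProj_le`). Inside this subspace each decoding operator has
trace at least about `2 ^ (n H(W|P) - δ)`, since it captures a fixed part of an output state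
whose eigenvalues are at most `2 ^ (-n H(W|P) + δ)`. So at most about `2 ^ (n I(P;W) + 2 δ)`
decoding operators fit (`CQ.card_le_of_hasType`).

*Direct part.* Take a code that is maximal among those with decoding operators of trace at most
`R = 2 ^ (n H(W|P) + O(√n))`, and let `B` be the sum of its decoding operators. If `B` hardly
detected some word `x` with a small typical projection `Q`, the code could be extended by `x` with
the decoding operator `(1 - B) Q (1 - B)`. So `B` detects all such words
(`CQ.exists_detecting_effect`), and, averaging over `P`, it detects `σ ⊗ ⋯ ⊗ σ`. This forces
`Tr B ≥ 2 ^ (n H(σ) - O(√n))`, while `Tr B ≤ N R` (`CQ.le_maxCodeSize`).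
-/

noncomputable section

namespace CQ

open scoped ComplexOrder
open Matrix

/-! ### The trace pairing and operator inequalities -/

section Pairing

variable {κ : Type*} [Fintype κ]

/-- The trace pairing `Re Tr(AB)` of two matrices. For a state `A` and an effect `B` it is the
probability of the outcome `B`. -/
def tracePair (A B : Matrix κ κ ℂ) : ℝ := (trace (A * B)).re

theorem tracePair_comm (A B : Matrix κ κ ℂ) : tracePair A B = tracePair B A := by
  rw [tracePair, tracePair, trace_mul_comm]

theorem tracePair_add_right (A B C : Matrix κ κ ℂ) :
    tracePair A (B + C) = tracePair A B + tracePair A C := by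
  simp [tracePair, mul_add]

theorem tracePair_add_left (A B C : Matrix κ κ ℂ) :
    tracePair (A + B) C = tracePair A C + tracePair B C := by
  simp [tracePair, add_mul]

theorem tracePair_sub_right (A B C : Matrix κ κ ℂ) :
    tracePair A (B - C) = tracePair A B - tracePair A C := by
  simp [tracePair, mul_sub]

theorem tracePair_smul_right (A B : Matrix κ κ ℂ) (c : ℝ) :
    tracePair A ((c : ℂ) • B) = c * tracePair A B := by
  simp [tracePair]

theorem tracePair_smul_left (A B : Matrix κ κ ℂ) (c : ℝ) :
    tracePair ((c : ℂ) • A) B = c * tracePair A B := by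
  simp [tracePair]

theorem tracePair_sum_right {α : Type*} (s : Finset α) (A : Matrix κ κ ℂ)
    (B : α → Matrix κ κ ℂ) : tracePair A (∑ i ∈ s, B i) = ∑ i ∈ s, tracePair A (B i) := by
  simp [tracePair, Finset.mul_sum, trace_sum]

theorem tracePair_sum_left {α : Type*} (s : Finset α) (A : α → Matrix κ κ ℂ)
    (B : Matrix κ κ ℂ) : tracePair (∑ i ∈ s, A i) B = ∑ i ∈ s, tracePair (A i) B := by
  simp [tracePair, Finset.sum_mul, trace_sum]

theorem tracePair_conj (A B C : Matrix κ κ ℂ) :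
    tracePair A (B * C * B) = tracePair (B * A * B) C := by
  rw [tracePair, tracePair, ← mul_assoc, trace_mul_comm]
  simp only [mul_assoc]

theorem _root_.Matrix.PosSemidef.conj_isHermitian {A D : Matrix κ κ ℂ} (hD : D.PosSemidef)
    (hA : A.IsHermitian) : (A * D * A).PosSemidef := by
  have h := hD.mul_mul_conjTranspose_same A
  rwa [hA.eq] at h

variable [DecidableEq κ]

theorem tracePair_nonneg {A B : Matrix κ κ ℂ} (hA : A.PosSemidef) (hB : B.PosSemidef) :
    0 ≤ tracePair A B := by
  obtain ⟨C, rfl⟩ : ∃ C : Matrix κ κ ℂ, A = Cᴴ * C := by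
    open scoped MatrixOrder in
    exact CStarAlgebra.nonneg_iff_eq_star_mul_self.mp (nonneg_iff_posSemidef.mpr hA)
  have h : 0 ≤ trace (C * B * Cᴴ) := (hB.mul_mul_conjTranspose_same C).trace_nonneg
  rw [tracePair, mul_assoc, trace_mul_comm]
  exact (Complex.le_def.mp h).1

theorem tracePair_mono_right {A B C : Matrix κ κ ℂ} (hA : A.PosSemidef)
    (h : (C - B).PosSemidef) : tracePair A B ≤ tracePair A C := by
  have := tracePair_nonneg hA h
  rw [tracePair_sub_right] at this
  linarith

theorem tracePair_mono_left {A B C : Matrix κ κ ℂ} (hA : A.PosSemidef)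
    (h : (C - B).PosSemidef) : tracePair B A ≤ tracePair C A := by
  rw [tracePair_comm B, tracePair_comm C]
  exact tracePair_mono_right hA h

/-- If an operator `A` is close to `1` then `D` is not much larger than `ADA`: this is the
parallelogram-type inequality `D ≤ (1 + t) ADA + (1 + t⁻¹) (1 - A) D (1 - A)`. It plays the role
of the gentle measurement lemma. -/
theorem posSemidef_pinching {A D : Matrix κ κ ℂ} (hA : A.IsHermitian) (hD : D.PosSemidef) {t : ℝ}
    (ht : 0 < t) :
    (((1 + t : ℝ) : ℂ) • (A * D * A) + ((1 + t⁻¹ : ℝ) : ℂ) • ((1 - A) * D * (1 - A))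
      - D).PosSemidef := by
  -- the difference is `t⁻¹` times the conjugate of `D` by `t A - (1 - A)`
  have h1 : ((t : ℂ) • A - (1 - A)).IsHermitian := by
    refine IsHermitian.sub ?_ (isHermitian_one.sub hA)
    rw [IsHermitian, conjTranspose_smul, hA.eq]
    simp
  have h := (hD.conj_isHermitian h1).smul
    (a := ((t⁻¹ : ℝ) : ℂ)) (by exact_mod_cast (inv_pos.mpr ht).le)
  convert h using 1
  have ht' : (t : ℂ) ≠ 0 := by exact_mod_cast ht.ne'
  have e1 : (t : ℂ)⁻¹ * t = 1 := inv_mul_cancel₀ ht'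
  simp only [Complex.ofReal_add, Complex.ofReal_one, Complex.ofReal_inv, add_smul, one_smul,
    sub_mul, mul_sub, smul_sub, smul_mul_assoc, mul_smul_comm, smul_smul, e1, one_mul, mul_one]
  rw [← mul_assoc, e1, one_mul]
  abel

theorem posSemidef_sub_sq {B : Matrix κ κ ℂ} (hB : B.PosSemidef) (hB1 : (1 - B).PosSemidef) :
    (B - B * B).PosSemidef := by
  have h := (hB1.conj_isHermitian hB.1).add (hB.conj_isHermitian hB1.1)
  convert h using 1
  noncomm_ring

end Pairing

/-! ### Functions of a diagonalized operator -/

section Spectral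

variable {κ : Type*} [Fintype κ] [DecidableEq κ]

/-- The matrix `U diag(w) Uᴴ`; for unitary `U`, the operator with eigenvalues `w` and
eigenvectors the columns of `U`. -/
def specMat (U : Matrix κ κ ℂ) (w : κ → ℝ) : Matrix κ κ ℂ :=
  U * diagonal (fun i => (w i : ℂ)) * Uᴴ

theorem specMat_sub (U : Matrix κ κ ℂ) (w v : κ → ℝ) :
    specMat U w - specMat U v = specMat U (w - v) := by
  simp only [specMat, ← sub_mul, ← mul_sub, diagonal_sub]
  simp

theorem specMat_smul (U : Matrix κ κ ℂ) (c : ℝ) (w : κ → ℝ) :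
    (c : ℂ) • specMat U w = specMat U (c • w) := by
  have : diagonal (fun i => ((c • w) i : ℂ)) = (c : ℂ) • diagonal (fun i => (w i : ℂ)) := by
    ext i j
    by_cases h : i = j <;> simp [h]
  rw [specMat, specMat, this]
  simp

theorem specMat_posSemidef (U : Matrix κ κ ℂ) {w : κ → ℝ} (hw : ∀ i, 0 ≤ w i) :
    (specMat U w).PosSemidef :=
  PosSemidef.mul_mul_conjTranspose_same
    (PosSemidef.diagonal fun i => by simpa using hw i) U

theorem specMat_sub_posSemidef (U : Matrix κ κ ℂ) {w v : κ → ℝ} (h : ∀ i, w i ≤ v i) :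
    (specMat U v - specMat U w).PosSemidef := by
  rw [specMat_sub]
  exact specMat_posSemidef U fun i => by simpa using h i

theorem specMat_one {U : Matrix κ κ ℂ} (hU : Uᴴ * U = 1) : specMat U (fun _ => 1) = 1 := by
  simp [specMat, mul_eq_one_comm.mp hU]

theorem specMat_mul {U : Matrix κ κ ℂ} (hU : Uᴴ * U = 1) (w v : κ → ℝ) :
    specMat U w * specMat U v = specMat U (w * v) := by
  have : specMat U w * specMat U v =
      U * (diagonal (fun i => (w i : ℂ)) * (Uᴴ * U) * diagonal (fun i => (v i : ℂ))) * Uᴴ := by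
    simp only [specMat, mul_assoc]
  rw [this, hU, mul_one, diagonal_mul_diagonal]
  simp [specMat]

theorem tracePair_specMat (A U : Matrix κ κ ℂ) (w : κ → ℝ) :
    tracePair A (specMat U w) = ∑ j, ((Uᴴ * A * U) j j).re * w j := by
  have : trace (A * specMat U w) = trace (Uᴴ * A * U * diagonal (fun i => (w i : ℂ))) := by
    rw [specMat, ← mul_assoc, trace_mul_comm]
    simp only [mul_assoc]
  rw [tracePair, this, trace]
  simp [mul_diagonal]

theorem trace_specMat {U : Matrix κ κ ℂ} (hU : Uᴴ * U = 1) (w : κ → ℝ) :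
    (trace (specMat U w)).re = ∑ j, w j := by
  have := tracePair_specMat 1 U w
  rw [mul_one, hU] at this
  simpa [tracePair] using this

/-- The orthogonal projection onto the span of the columns `U j`, `j ∈ S`, of a unitary `U`. -/
def specProj (U : Matrix κ κ ℂ) (S : Set κ) : Matrix κ κ ℂ :=
  specMat U (S.indicator 1)

theorem specProj_posSemidef (U : Matrix κ κ ℂ) (S : Set κ) : (specProj U S).PosSemidef :=
  specMat_posSemidef U fun i => Set.indicator_nonneg (by simp) i

theorem one_sub_specProj {U : Matrix κ κ ℂ} (hU : Uᴴ * U = 1) (S : Set κ) :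
    1 - specProj U S = specProj U Sᶜ := by
  rw [← specMat_one hU, specProj, specProj, specMat_sub]
  congr 1
  ext i
  by_cases h : i ∈ S <;> simp [h]

theorem specProj_mul_self {U : Matrix κ κ ℂ} (hU : Uᴴ * U = 1) (S : Set κ) :
    specProj U S * specProj U S = specProj U S := by
  rw [specProj, specMat_mul hU]
  congr 1
  ext i
  by_cases h : i ∈ S <;> simp [h]

end Spectral

/-! ### Tensor products of matrices -/

section Tensor

variable {ι : Type*} {n : ℕ}

/-- The matrix of `A₁ ⊗ ⋯ ⊗ Aₙ` in the product basis. -/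
def tens (A : Fin n → Matrix ι ι ℂ) : Matrix (Fin n → ι) (Fin n → ι) ℂ :=
  Matrix.of fun i j => ∏ k, A k (i k) (j k)

theorem conjTranspose_tens (A : Fin n → Matrix ι ι ℂ) : (tens A)ᴴ = tens fun k => (A k)ᴴ := by
  ext i j
  simp [tens]

theorem tens_mul [Fintype ι] (A B : Fin n → Matrix ι ι ℂ) :
    tens A * tens B = tens fun k => A k * B k := by
  ext i j
  simp only [tens, mul_apply, of_apply, ← Finset.prod_mul_distrib]
  rw [Finset.prod_univ_sum, Fintype.piFinset_univ]

variable [DecidableEq ι]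

theorem tens_diagonal (w : Fin n → ι → ℝ) :
    tens (fun k => diagonal fun j => (w k j : ℂ)) =
      diagonal fun j => ((∏ k, w k (j k) : ℝ) : ℂ) := by
  ext i j
  by_cases h : i = j
  · subst h
    simp [tens]
  · obtain ⟨k, hk⟩ := Function.ne_iff.mp h
    rw [diagonal_apply_ne _ h]
    exact Finset.prod_eq_zero (Finset.mem_univ k) (diagonal_apply_ne _ hk)

theorem tens_one : tens (fun _ : Fin n => (1 : Matrix ι ι ℂ)) = 1 := by
  simpa using tens_diagonal (n := n) (ι := ι) fun _ _ => 1

variable [Fintype ι]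

theorem tens_unitary {U : Fin n → Matrix ι ι ℂ} (hU : ∀ k, (U k)ᴴ * U k = 1) :
    (tens U)ᴴ * tens U = 1 := by
  rw [conjTranspose_tens, tens_mul]
  simp only [hU, tens_one]

theorem tens_specMat (U : Fin n → Matrix ι ι ℂ) (w : Fin n → ι → ℝ) :
    tens (fun k => specMat (U k) (w k)) = specMat (tens U) fun j => ∏ k, w k (j k) := by
  rw [specMat, conjTranspose_tens, ← tens_diagonal, tens_mul, tens_mul]
  rfl

end Tensor

/-! ### Product distributions -/

section Classical

variable {ι : Type*} [Fintype ι] {n : ℕ}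

theorem sum_prod_eq_one {q : Fin n → ι → ℝ} (hq : ∀ k, ∑ j, q k j = 1) :
    ∑ j : Fin n → ι, ∏ k, q k (j k) = 1 := by
  classical
  rw [← Fintype.piFinset_univ, ← Finset.prod_univ_sum]
  simp [hq]

/-- The second moment of a constant plus a sum of independent centred random variables. -/
theorem sum_prod_mul_sq {n : ℕ} (q g : Fin n → ι → ℝ) (hq : ∀ k, ∑ j, q k j = 1)
    (hg : ∀ k, ∑ j, q k j * g k j = 0) (c : ℝ) :
    ∑ j : Fin n → ι, (∏ k, q k (j k)) * (c + ∑ k, g k (j k)) ^ 2 =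
      c ^ 2 + ∑ k, ∑ j, q k j * g k j ^ 2 := by
  induction n generalizing c with
  | zero => simp
  | succ n ih =>
    rw [← (Fin.consEquiv fun _ => ι).sum_comp, Fintype.sum_prod_type]
    have h : ∀ a : ι, ∑ j : Fin n → ι,
        (∏ k, q k ((Fin.consEquiv fun _ => ι) (a, j) k)) *
          (c + ∑ k, g k ((Fin.consEquiv fun _ => ι) (a, j) k)) ^ 2 =
        q 0 a * ((c + g 0 a) ^ 2 + ∑ k : Fin n, ∑ j, q k.succ j * g k.succ j ^ 2) := by
      intro a
      rw [← ih (fun k => q k.succ) (fun k => g k.succ) (fun k => hq _) (fun k => hg _),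
        Finset.mul_sum]
      refine Finset.sum_congr rfl fun j _ => ?_
      simp [Fin.consEquiv, Fin.prod_univ_succ, Fin.sum_univ_succ]
      ring
    simp only [h]
    rw [Fin.sum_univ_succ]
    have e : ∀ a, q 0 a * ((c + g 0 a) ^ 2 + ∑ k : Fin n, ∑ j, q k.succ j * g k.succ j ^ 2) =
        q 0 a * (c ^ 2 + ∑ k : Fin n, ∑ j, q k.succ j * g k.succ j ^ 2) +
        q 0 a * g 0 a * (2 * c) + q 0 a * g 0 a ^ 2 := fun a => by ring
    simp only [e, Finset.sum_add_distrib, ← Finset.sum_mul, hq, hg]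
    ring

/-- Chebyshev's inequality for a sum of independent random variables `f k`, with the second
moments in place of the variances. -/
theorem chebyshev_prod {q f : Fin n → ι → ℝ} (hq0 : ∀ k j, 0 ≤ q k j)
    (hq : ∀ k, ∑ j, q k j = 1) {M V δ : ℝ} (hM : ∑ k, ∑ j, q k j * f k j = M)
    (hV : ∑ k, ∑ j, q k j * f k j ^ 2 ≤ V) (hδ : 0 < δ) (S : Finset (Fin n → ι))
    (hS : ∀ j ∈ S, δ ≤ |∑ k, f k (j k) - M|) :
    ∑ j ∈ S, ∏ k, q k (j k) ≤ V / δ ^ 2 := by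
  set m : Fin n → ℝ := fun k => ∑ j, q k j * f k j with hm
  have hp : ∀ j : Fin n → ι, 0 ≤ ∏ k, q k (j k) :=
    fun j => Finset.prod_nonneg fun k _ => hq0 k _
  have h := sum_prod_mul_sq q (fun k j => f k j - m k) hq
    (fun k => by simp [mul_sub, Finset.sum_sub_distrib, ← Finset.sum_mul, hq, hm]) 0
  have hsum : ∀ j : Fin n → ι, 0 + ∑ k, (f k (j k) - m k) = ∑ k, f k (j k) - M := by
    intro j
    rw [Finset.sum_sub_distrib, ← hM, zero_add]
  simp only [hsum] at h
  have hle : ∀ k, ∑ j, q k j * (f k j - m k) ^ 2 ≤ ∑ j, q k j * f k j ^ 2 := by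
    intro k
    have e : ∀ j, q k j * (f k j - m k) ^ 2 =
        q k j * f k j ^ 2 - q k j * f k j * (2 * m k) + q k j * m k ^ 2 := fun j => by ring
    simp only [e, Finset.sum_add_distrib, Finset.sum_sub_distrib, ← Finset.sum_mul, hq]
    have : ∑ j, q k j * f k j = m k := rfl
    rw [this]
    nlinarith [sq_nonneg (m k)]
  rw [le_div_iff₀ (by positivity), Finset.sum_mul]
  calc ∑ j ∈ S, (∏ k, q k (j k)) * δ ^ 2
      ≤ ∑ j ∈ S, (∏ k, q k (j k)) * (∑ k, f k (j k) - M) ^ 2 := by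
        refine Finset.sum_le_sum fun j hj => mul_le_mul_of_nonneg_left ?_ (hp j)
        rw [← sq_abs (∑ k, f k (j k) - M)]
        exact pow_le_pow_left₀ hδ.le (hS j hj) 2
    _ ≤ ∑ j : Fin n → ι, (∏ k, q k (j k)) * (∑ k, f k (j k) - M) ^ 2 :=
        Finset.sum_le_sum_of_subset_of_nonneg (Finset.subset_univ S)
          fun j _ _ => mul_nonneg (hp j) (sq_nonneg _)
    _ ≤ V := by
        rw [h]
        have := Finset.sum_le_sum fun k (_ : k ∈ Finset.univ) => hle k
        linarith

theorem mul_logb_sq_le {p : ℝ} (h0 : 0 ≤ p) (h1 : p ≤ 1) : p * Real.logb 2 p ^ 2 ≤ 9 := by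
  rcases h0.eq_or_lt with rfl | hp
  · simp
  have h := Real.abs_log_mul_self_rpow_lt p (1 / 2) hp h1 (by norm_num)
  have h2 : (0.6931471803 : ℝ) < Real.log 2 := Real.log_two_gt_d9
  have h3 : (Real.log p * p ^ (1 / 2 : ℝ)) ^ 2 ≤ 4 := by
    rw [← sq_abs]
    have := abs_nonneg (Real.log p * p ^ (1 / 2 : ℝ))
    norm_num at h this ⊢
    nlinarith
  rw [mul_pow, ← Real.rpow_natCast (p ^ (1 / 2 : ℝ)), ← Real.rpow_mul hp.le] at h3
  norm_num at h3
  rw [Real.logb, div_pow, ← mul_div_assoc, div_le_iff₀ (by positivity)]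
  nlinarith

theorem neg_mul_logb_mem {p : ℝ} (h0 : 0 ≤ p) (h1 : p ≤ 1) :
    0 ≤ -(p * Real.logb 2 p) ∧ -(p * Real.logb 2 p) ≤ 9 := by
  have hl : Real.logb 2 p ≤ 0 := Real.logb_nonpos one_lt_two h0 h1
  have := mul_logb_sq_le h0 h1
  constructor
  · nlinarith
  · by_cases h : -Real.logb 2 p ≤ 1
    · nlinarith
    · push Not at h
      nlinarith [mul_nonneg h0 (neg_nonneg.mpr hl)]

/-- Spectral typicality. Let the independent positions `k` have distributions `q k`, and let
`s k` be nonnegative weights that vanish only where `q k` does. With `M` the expectation of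
`-log ∏ s k`, the product `∏ s k (j k)` lies within a factor `2 ^ δ` of `2 ^ (-M)` outside a set of probability
at most `V / δ ^ 2`. -/
theorem typical_prod {q s : Fin n → ι → ℝ} (hq0 : ∀ k j, 0 ≤ q k j)
    (hq : ∀ k, ∑ j, q k j = 1) (hs0 : ∀ k j, 0 ≤ s k j) (hac : ∀ k j, s k j = 0 → q k j = 0)
    {M V δ : ℝ} (hM : ∑ k, ∑ j, q k j * -Real.logb 2 (s k j) = M)
    (hV : ∑ k, ∑ j, q k j * Real.logb 2 (s k j) ^ 2 ≤ V) (hδ : 0 < δ)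
    (S : Finset (Fin n → ι))
    (hS : ∀ j ∈ S, ∏ k, s k (j k) ≤ (2 : ℝ) ^ (-M - δ) ∨ (2 : ℝ) ^ (-M + δ) ≤ ∏ k, s k (j k)) :
    ∑ j ∈ S, ∏ k, q k (j k) ≤ V / δ ^ 2 := by
  classical
  -- outside the support of the `s k` the probability vanishes, so logarithms may be taken
  have h0 : ∑ j ∈ S, ∏ k, q k (j k) =
      ∑ j ∈ S.filter (fun j => ∀ k, s k (j k) ≠ 0), ∏ k, q k (j k) := by
    rw [Finset.sum_filter]
    refine Finset.sum_congr rfl fun j _ => ?_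
    split_ifs with h
    · rfl
    · push Not at h
      obtain ⟨k, hk⟩ := h
      exact Finset.prod_eq_zero (Finset.mem_univ k) (hac _ _ hk)
  rw [h0]
  refine chebyshev_prod hq0 hq hM (by simpa using hV) hδ _ fun j hj => ?_
  rw [Finset.mem_filter] at hj
  obtain ⟨hj, hne⟩ := hj
  have hpos : ∀ k, 0 < s k (j k) := fun k => lt_of_le_of_ne (hs0 _ _) (hne k).symm
  have hprod : ∏ k, s k (j k) = (2 : ℝ) ^ (-∑ k, -Real.logb 2 (s k (j k))) := by
    rw [Finset.sum_neg_distrib, neg_neg, Real.rpow_sum_of_pos two_pos]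
    exact Finset.prod_congr rfl fun k _ =>
      (Real.rpow_logb two_pos (by norm_num) (hpos k)).symm
  have h := hS j hj
  rw [hprod, Real.rpow_le_rpow_left_iff one_lt_two, Real.rpow_le_rpow_left_iff one_lt_two] at h
  rw [le_abs]
  rcases h with h | h
  · left; linarith
  · right; linarith

end Classical

/-! ### Typical subspaces of product states -/

section States

variable {ι : Type*} [Fintype ι]

/-- The distribution of the outcome of a measurement of the state `ρ` in the orthonormal basis
formed by the columns of `U`. -/
def State.dist (ρ : State ι) (U : Matrix ι ι ℂ) (j : ι) : ℝ := ((Uᴴ * ρ.mat * U) j j).re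

theorem State.dist_nonneg (ρ : State ι) (U : Matrix ι ι ℂ) (j : ι) : 0 ≤ ρ.dist U j :=
  (Complex.le_def.mp (ρ.posSemidef.conjTranspose_mul_mul_same U).diag_nonneg).1

theorem State.coe_dist (ρ : State ι) (U : Matrix ι ι ℂ) (j : ι) :
    (Uᴴ * ρ.mat * U) j j = (ρ.dist U j : ℂ) := by
  have h : 0 ≤ (Uᴴ * ρ.mat * U) j j := (ρ.posSemidef.conjTranspose_mul_mul_same U).diag_nonneg
  exact Complex.ext rfl (by simpa using (Complex.le_def.mp h).2.symm)

variable [DecidableEq ι]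

/-- The eigenvalues of a state. -/
def State.eig (ρ : State ι) : ι → ℝ := ρ.posSemidef.isHermitian.eigenvalues

/-- A unitary matrix whose columns are eigenvectors of a state. -/
def State.eigU (ρ : State ι) : Matrix ι ι ℂ := ρ.posSemidef.isHermitian.eigenvectorUnitary

theorem State.eigU_unitary (ρ : State ι) : (ρ.eigU)ᴴ * ρ.eigU = 1 :=
  Unitary.coe_star_mul_self ρ.posSemidef.isHermitian.eigenvectorUnitary

theorem State.mat_eq_specMat (ρ : State ι) : ρ.mat = specMat ρ.eigU ρ.eig := by
  conv_lhs => rw [ρ.posSemidef.isHermitian.spectral_theorem, Unitary.conjStarAlgAut_apply]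
  rfl

theorem State.eig_nonneg (ρ : State ι) (j : ι) : 0 ≤ ρ.eig j := ρ.posSemidef.eigenvalues_nonneg j

theorem State.sum_eig (ρ : State ι) : ∑ j, ρ.eig j = 1 := by
  rw [← trace_specMat ρ.eigU_unitary, ← ρ.mat_eq_specMat, ρ.trace_eq_one, Complex.one_re]

theorem State.eig_le_one (ρ : State ι) (j : ι) : ρ.eig j ≤ 1 :=
  ρ.sum_eig ▸ Finset.single_le_sum (fun i _ => ρ.eig_nonneg i) (Finset.mem_univ j)

theorem entropy_eq (ρ : State ι) : entropy ρ = ∑ j, ρ.eig j * -Real.logb 2 (ρ.eig j) := by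
  simp only [mul_neg, Finset.sum_neg_distrib]
  rfl

theorem entropy_nonneg (ρ : State ι) : 0 ≤ entropy ρ := by
  rw [entropy_eq]
  refine Finset.sum_nonneg fun j _ => ?_
  have := (neg_mul_logb_mem (ρ.eig_nonneg j) (ρ.eig_le_one j)).1
  linarith

theorem entropy_le (ρ : State ι) : entropy ρ ≤ 9 * Fintype.card ι := by
  rw [entropy_eq]
  refine (Finset.sum_le_card_nsmul _ _ 9 fun j _ => ?_).trans (by simp [mul_comm])
  have := (neg_mul_logb_mem (ρ.eig_nonneg j) (ρ.eig_le_one j)).2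
  linarith

theorem sum_eig_mul_logb_sq_le (ρ : State ι) :
    ∑ j, ρ.eig j * Real.logb 2 (ρ.eig j) ^ 2 ≤ 9 * Fintype.card ι :=
  (Finset.sum_le_card_nsmul _ _ 9 fun j _ =>
    mul_logb_sq_le (ρ.eig_nonneg j) (ρ.eig_le_one j)).trans (by simp [mul_comm])

theorem State.sum_dist (ρ : State ι) {U : Matrix ι ι ℂ} (hU : Uᴴ * U = 1) :
    ∑ j, ρ.dist U j = 1 := by
  have h : trace (Uᴴ * ρ.mat * U) = 1 := by
    rw [mul_assoc, trace_mul_comm, mul_assoc, mul_eq_one_comm.mp hU, mul_one, ρ.trace_eq_one]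
  have := congrArg Complex.re h
  simpa [trace, State.dist] using this

theorem State.dist_eigU (ρ : State ι) : ρ.dist ρ.eigU = ρ.eig := by
  ext j
  have : (ρ.eigU)ᴴ * ρ.mat * ρ.eigU = diagonal fun i => (ρ.eig i : ℂ) := by
    have h := ρ.mat_eq_specMat
    rw [specMat] at h
    rw [h]
    calc _ = (ρ.eigUᴴ * ρ.eigU) * diagonal (fun i => (ρ.eig i : ℂ)) * (ρ.eigUᴴ * ρ.eigU) := by
          simp only [mul_assoc]
      _ = _ := by rw [ρ.eigU_unitary, one_mul, mul_one]
  rw [State.dist, this]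
  simp

variable {X : Type*} [Fintype X]

theorem dist_avgState (P : stdSimplex ℝ X) (W : Channel X ι) (U : Matrix ι ι ℂ) (j : ι) :
    (avgState P W).dist U j = ∑ x, P x * (W x).dist U j := by
  simp [State.dist, avgState, Finset.mul_sum, Finset.sum_mul, Matrix.sum_apply]

variable {n : ℕ}

theorem tracePair_tens_specMat (ρ : Fin n → State ι) (U : Fin n → Matrix ι ι ℂ)
    (w : (Fin n → ι) → ℝ) :
    tracePair (tens fun k => (ρ k).mat) (specMat (tens U) w) =
      ∑ j, (∏ k, (ρ k).dist (U k) (j k)) * w j := by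
  rw [tracePair_specMat, conjTranspose_tens, tens_mul, tens_mul]
  refine Finset.sum_congr rfl fun j _ => ?_
  congr 1
  simp only [tens, of_apply, State.coe_dist]
  rw [← Complex.ofReal_prod, Complex.ofReal_re]

theorem tens_eig (ρ : Fin n → State ι) :
    tens (fun k => (ρ k).mat) =
      specMat (tens fun k => (ρ k).eigU) fun j => ∏ k, (ρ k).eig (j k) := by
  rw [← tens_specMat]
  simp only [← State.mat_eq_specMat]

theorem tens_state_posSemidef (ρ : Fin n → State ι) :
    (tens fun k => (ρ k).mat).PosSemidef := by
  rw [tens_eig]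
  exact specMat_posSemidef _ fun j => Finset.prod_nonneg fun k _ => (ρ k).eig_nonneg _

theorem tracePair_tens_state_one (ρ : Fin n → State ι) :
    tracePair (tens fun k => (ρ k).mat) 1 = 1 := by
  rw [tracePair, mul_one, tens_eig, trace_specMat (tens_unitary fun k => (ρ k).eigU_unitary)]
  exact sum_prod_eq_one fun k => (ρ k).sum_eig

/-- The indices of the eigenvectors of `σ₁ ⊗ ⋯ ⊗ σₙ` whose eigenvalue is strictly within a
factor `2 ^ δ` of `2 ^ (-∑ H(σₖ))`. -/
def typSet (σ : Fin n → State ι) (δ : ℝ) : Set (Fin n → ι) :=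
  {j | (2 : ℝ) ^ (-(∑ k, entropy (σ k)) - δ) < ∏ k, (σ k).eig (j k) ∧
    ∏ k, (σ k).eig (j k) < (2 : ℝ) ^ (-(∑ k, entropy (σ k)) + δ)}

/-- The entropy-typical projection of the product state `σ₁ ⊗ ⋯ ⊗ σₙ`. -/
def typProj (σ : Fin n → State ι) (δ : ℝ) : Matrix (Fin n → ι) (Fin n → ι) ℂ :=
  specProj (tens fun k => (σ k).eigU) (typSet σ δ)

theorem typProj_posSemidef (σ : Fin n → State ι) (δ : ℝ) : (typProj σ δ).PosSemidef :=
  specProj_posSemidef _ _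

theorem one_sub_typProj_eq (σ : Fin n → State ι) (δ : ℝ) :
    1 - typProj σ δ = specProj (tens fun k => (σ k).eigU) (typSet σ δ)ᶜ :=
  one_sub_specProj (tens_unitary fun k => (σ k).eigU_unitary) _

theorem one_sub_typProj_posSemidef (σ : Fin n → State ι) (δ : ℝ) :
    (1 - typProj σ δ).PosSemidef := by
  rw [one_sub_typProj_eq]
  exact specProj_posSemidef _ _

theorem typProj_mul_self (σ : Fin n → State ι) (δ : ℝ) :
    typProj σ δ * typProj σ δ = typProj σ δ :=
  specProj_mul_self (tens_unitary fun k => (σ k).eigU_unitary) _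

/-- A product state `ρ`, not necessarily commuting with `σ`, is nearly supported on the typical
subspace of `σ` as soon as its outcome distributions in the eigenbases of the `σₖ` give
`-log σ` the expectation `∑ H(σₖ)` and a small second moment. -/
theorem tracePair_one_sub_typProj_le (ρ σ : Fin n → State ι) {V δ : ℝ} (hδ : 0 < δ)
    (hac : ∀ k j, (σ k).eig j = 0 → (ρ k).dist (σ k).eigU j = 0)
    (hM : ∑ k, ∑ j, (ρ k).dist (σ k).eigU j * -Real.logb 2 ((σ k).eig j) =
      ∑ k, entropy (σ k))
    (hV : ∑ k, ∑ j, (ρ k).dist (σ k).eigU j * Real.logb 2 ((σ k).eig j) ^ 2 ≤ V) :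
    tracePair (tens fun k => (ρ k).mat) (1 - typProj σ δ) ≤ V / δ ^ 2 := by
  classical
  rw [one_sub_typProj_eq, specProj, tracePair_tens_specMat]
  have h := typical_prod (fun k j => (ρ k).dist_nonneg (σ k).eigU j)
    (fun k => (ρ k).sum_dist (σ k).eigU_unitary) (fun k => (σ k).eig_nonneg) hac hM hV hδ
    (Finset.univ.filter fun j => j ∈ (typSet σ δ)ᶜ) (fun j hj => by
      have hj' := (Finset.mem_filter.mp hj).2
      by_contra hcon
      push Not at hcon
      exact hj' hcon)
  rw [Finset.sum_filter] at h
  refine le_of_eq_of_le (Finset.sum_congr rfl fun j _ => ?_) h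
  by_cases hj : j ∈ typSet σ δ <;> simp [hj]

theorem tracePair_self_one_sub_typProj_le (σ : Fin n → State ι) {δ : ℝ} (hδ : 0 < δ) :
    tracePair (tens fun k => (σ k).mat) (1 - typProj σ δ) ≤
      n * (9 * Fintype.card ι) / δ ^ 2 := by
  refine tracePair_one_sub_typProj_le σ σ hδ ?_ ?_ ?_
  · simp [State.dist_eigU]
  · simp only [State.dist_eigU, entropy_eq]
  · simp only [State.dist_eigU]
    exact (Finset.sum_le_card_nsmul _ _ _ fun k _ => sum_eig_mul_logb_sq_le (σ k)).trans
      (by simp)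

/-- The dimension of the typical subspace. -/
theorem trace_typProj_le (σ : Fin n → State ι) (δ : ℝ) :
    tracePair 1 (typProj σ δ) ≤ (2 : ℝ) ^ (∑ k, entropy (σ k) + δ) := by
  rw [tracePair, one_mul, typProj, specProj,
    trace_specMat (tens_unitary fun k => (σ k).eigU_unitary),
    ← one_mul ((2 : ℝ) ^ _), ← sum_prod_eq_one fun k => (σ k).sum_eig, Finset.sum_mul]
  refine Finset.sum_le_sum fun j _ => ?_
  have h0 : 0 ≤ ∏ k, (σ k).eig (j k) := Finset.prod_nonneg fun k _ => (σ k).eig_nonneg _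
  by_cases hj : j ∈ typSet σ δ
  · rw [Set.indicator_of_mem hj, Pi.one_apply]
    have h1 : (1 : ℝ) = (2 : ℝ) ^ (-(∑ k, entropy (σ k)) - δ) *
        (2 : ℝ) ^ (∑ k, entropy (σ k) + δ) := by
      rw [← Real.rpow_add two_pos]
      ring_nf
      simp
    rw [h1]
    gcongr
    exact hj.1.le
  · rw [Set.indicator_of_notMem hj]
    positivity

/-- Up to the small weight outside its typical subspace, a product state is bounded by the
largest typical eigenvalue. -/
theorem tracePair_tens_le (σ : Fin n → State ι) {δ : ℝ} (hδ : 0 < δ)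
    {B : Matrix (Fin n → ι) (Fin n → ι) ℂ} (hB : B.PosSemidef) (hB1 : (1 - B).PosSemidef) :
    tracePair (tens fun k => (σ k).mat) B ≤
      (2 : ℝ) ^ (-(∑ k, entropy (σ k)) + δ) * tracePair 1 B +
        n * (9 * Fintype.card ι) / δ ^ 2 := by
  set U : Matrix (Fin n → ι) (Fin n → ι) ℂ := tens fun k => (σ k).eigU with hUdef
  have hU : Uᴴ * U = 1 := tens_unitary fun k => (σ k).eigU_unitary
  set r : (Fin n → ι) → ℝ := fun j => ∏ k, (σ k).eig (j k) with hr
  have hr0 : ∀ j, 0 ≤ r j := fun j => Finset.prod_nonneg fun k _ => (σ k).eig_nonneg _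
  -- split the eigenvalues into the typical and the atypical ones
  have hsplit : specMat U r - specMat U ((typSet σ δ).indicator r) =
      specMat U ((typSet σ δ)ᶜ.indicator r) := by
    rw [specMat_sub, Set.indicator_compl]
  have h1 : tracePair (specMat U ((typSet σ δ).indicator r)) B ≤
      (2 : ℝ) ^ (-(∑ k, entropy (σ k)) + δ) * tracePair 1 B := by
    rw [← tracePair_smul_left, ← specMat_one hU, specMat_smul]
    refine tracePair_mono_left hB (specMat_sub_posSemidef U fun j => ?_)
    by_cases hj : j ∈ typSet σ δ
    · simpa [hj] using hj.2.le
    · simp only [hj, not_false_eq_true, Set.indicator_of_notMem, Pi.smul_apply, smul_eq_mul,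
        mul_one]
      positivity
  have h2 : tracePair (specMat U ((typSet σ δ)ᶜ.indicator r)) B ≤
      n * (9 * Fintype.card ι) / δ ^ 2 := by
    refine (tracePair_mono_right (specMat_posSemidef U
      fun j => Set.indicator_nonneg (fun j _ => hr0 j) j) hB1).trans ?_
    refine le_of_eq_of_le ?_ (tracePair_self_one_sub_typProj_le σ hδ)
    rw [tracePair, mul_one, trace_specMat hU, one_sub_typProj_eq, specProj,
      tracePair_tens_specMat]
    refine Finset.sum_congr rfl fun j _ => ?_
    simp only [State.dist_eigU]
    by_cases hj : j ∈ typSet σ δ <;> simp [hj, hr]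
  rw [tens_eig, ← sub_add_cancel (specMat U r) (specMat U ((typSet σ δ).indicator r)), hsplit]
  rw [tracePair_add_left]
  linarith

end States

/-! ### The strong converse -/

theorem outputMat_eq_tens {X ι : Type*} [Fintype ι] {n : ℕ} (W : Channel X ι) (x : Fin n → X) :
    outputMat W x = tens fun k => (W (x k)).mat := rfl

section Converse

variable {X ι : Type*} [Fintype X] [Fintype ι] [DecidableEq ι] {n : ℕ}

/-- A word `x` has type `P` if averages over its letters are averages with respect to `P`. -/
def HasType (P : stdSimplex ℝ X) (x : Fin n → X) : Prop :=
  ∀ g : X → ℝ, ∑ k, g (x k) = n * ∑ a, P a * g a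

theorem HasType.ne_zero {P : stdSimplex ℝ X} {x : Fin n → X} (h : HasType P x) (k : Fin n) :
    P (x k) ≠ 0 := by
  classical
  intro h0
  have h1 := h fun a => if a = x k then 1 else 0
  simp only [mul_ite, mul_one, mul_zero, Finset.sum_ite_eq', Finset.mem_univ, if_true, h0] at h1
  have h2 := Finset.single_le_sum (f := fun l => if x l = x k then (1 : ℝ) else 0)
    (fun l _ => by split_ifs <;> norm_num) (Finset.mem_univ k)
  simp only [if_true] at h2
  linarith

theorem HasType.sum_entropy {P : stdSimplex ℝ X} {x : Fin n → X} (h : HasType P x)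
    (W : Channel X ι) : ∑ k, entropy (W (x k)) = n * condEntropy P W :=
  h fun a => entropy (W a)

/-- The output of a word of type `P` is nearly supported on the typical subspace of the `n`-fold
average output state. The mean and second moment of `-log PW` are those under `PW` itself, because
averaging over the letters of the word reproduces `PW`. -/
theorem HasType.tracePair_one_sub_typProj_le {P : stdSimplex ℝ X} {x : Fin n → X}
    (h : HasType P x) (W : Channel X ι) {δ : ℝ} (hδ : 0 < δ) :
    tracePair (outputMat W x) (1 - typProj (fun _ : Fin n => avgState P W) δ) ≤
      n * (9 * Fintype.card ι) / δ ^ 2 := by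
  set σ := avgState P W with hσ
  have havg : ∀ f : ι → ℝ,
      ∑ k, ∑ j, (W (x k)).dist σ.eigU j * f j = n * ∑ j, σ.eig j * f j := by
    intro f
    rw [h fun a => ∑ j, (W a).dist σ.eigU j * f j, ← State.dist_eigU σ]
    congr 1
    simp only [hσ, dist_avgState, Finset.mul_sum, Finset.sum_mul, mul_assoc]
    exact Finset.sum_comm
  rw [outputMat_eq_tens]
  refine CQ.tracePair_one_sub_typProj_le (fun k => W (x k)) (fun _ => σ) hδ ?_ ?_ ?_
  · intro k j hj
    rw [← State.dist_eigU, dist_avgState] at hj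
    have h0 := (Finset.sum_eq_zero_iff_of_nonneg fun a _ =>
      mul_nonneg (P.2.1 a) ((W a).dist_nonneg σ.eigU j)).mp hj (x k) (Finset.mem_univ _)
    exact (mul_eq_zero.mp h0).resolve_left (h.ne_zero k)
  · rw [havg, ← entropy_eq]
    simp
  · rw [havg]
    exact mul_le_mul_of_nonneg_left (sum_eig_mul_logb_sq_le σ) (Nat.cast_nonneg n)

/-- A decoding operator `D` that recognizes a word of type `P` has trace at least about
`2 ^ (n H(W|P))` inside the typical subspace of the average output. -/
theorem HasType.le_tracePair_typProj {P : stdSimplex ℝ X} {x : Fin n → X}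
    (h : HasType P x) (W : Channel X ι) {δ lam : ℝ} (hδ : 0 < δ)
    (hδl : n * (9 * Fintype.card ι) / δ ^ 2 ≤ (1 - lam) / 8)
    {D : Matrix (Fin n → ι) (Fin n → ι) ℂ} (hD : D.PosSemidef) (hD1 : (1 - D).PosSemidef)
    (hx : 1 - lam ≤ tracePair (outputMat W x) D) :
    (1 - lam) / 4 ≤ (2 : ℝ) ^ (-(n * condEntropy P W) + δ) *
      tracePair D (typProj (fun _ : Fin n => avgState P W) δ) := by
  set Q := typProj (fun _ : Fin n => avgState P W) δ with hQ
  have hQ0 : Q.PosSemidef := typProj_posSemidef _ _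
  have hQ1 : (1 - Q).PosSemidef := one_sub_typProj_posSemidef _ _
  have hQQ : Q * Q = Q := typProj_mul_self _ _
  have hρ : (outputMat W x).PosSemidef := tens_state_posSemidef fun k => W (x k)
  -- the compression `QDQ` is again an effect
  have hQDQ : (Q * D * Q).PosSemidef := hD.conj_isHermitian hQ0.1
  have hQDQ1 : (1 - Q * D * Q).PosSemidef := by
    have h1 := (hD1.conj_isHermitian hQ0.1).add hQ1
    convert h1 using 1
    rw [mul_sub, sub_mul, mul_one, hQQ]
    abel
  have h1 := tracePair_tens_le (fun k => W (x k)) hδ hQDQ hQDQ1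
  rw [h.sum_entropy W, ← outputMat_eq_tens, tracePair_conj 1, mul_one, hQQ,
    tracePair_comm Q D] at h1
  have h2 : tracePair (outputMat W x) ((1 - Q) * D * (1 - Q)) ≤
      n * (9 * Fintype.card ι) / δ ^ 2 := by
    refine (tracePair_mono_right hρ ?_).trans (h.tracePair_one_sub_typProj_le W hδ)
    have h3 := hD1.conj_isHermitian hQ1.1
    convert h3 using 1
    have : (1 - Q) * (1 - Q) = 1 - Q := by
      rw [mul_sub, sub_mul, sub_mul, one_mul, mul_one, hQQ]
      simp
    rw [mul_sub (1 - Q) 1 D, mul_one, sub_mul (1 - Q) ((1 - Q) * D), this]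
  have h3 := tracePair_mono_right hρ (posSemidef_pinching hQ0.1 hD one_pos)
  rw [tracePair_add_right, tracePair_smul_right, tracePair_smul_right] at h3
  norm_num at h3
  linarith

/-- The strong converse for codes all of whose codewords have the same type. -/
theorem card_le_of_hasType {α : Type*} (s : Finset α) (P : stdSimplex ℝ X) (W : Channel X ι)
    {δ lam : ℝ} (hδ : 0 < δ) (hδl : n * (9 * Fintype.card ι) / δ ^ 2 ≤ (1 - lam) / 8)
    (x : α → Fin n → X) (D : α → Matrix (Fin n → ι) (Fin n → ι) ℂ)
    (hx : ∀ m ∈ s, HasType P (x m)) (hD : ∀ m, (D m).PosSemidef)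
    (hDs : (1 - ∑ m ∈ s, D m).PosSemidef)
    (herr : ∀ m ∈ s, 1 - lam ≤ tracePair (outputMat W (x m)) (D m)) :
    s.card * ((1 - lam) / 4) ≤ (2 : ℝ) ^ (n * mutualInfo P W + 2 * δ) := by
  classical
  set Q := typProj (fun _ : Fin n => avgState P W) δ with hQ
  have h1 : ∀ m ∈ s, (1 - D m).PosSemidef := by
    intro m hm
    have := hDs.add (posSemidef_sum (s.erase m) fun i _ => hD i)
    rw [← Finset.add_sum_erase s D hm] at this
    convert this using 1
    abel
  have h2 : ∑ m ∈ s, tracePair (D m) Q ≤ tracePair 1 Q := by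
    rw [← tracePair_sum_left]
    exact tracePair_mono_left (typProj_posSemidef _ _) hDs
  calc (s.card : ℝ) * ((1 - lam) / 4)
      = ∑ m ∈ s, (1 - lam) / 4 := by simp
    _ ≤ ∑ m ∈ s, (2 : ℝ) ^ (-(n * condEntropy P W) + δ) * tracePair (D m) Q :=
        Finset.sum_le_sum fun m hm =>
          (hx m hm).le_tracePair_typProj W hδ hδl (hD m) (h1 m hm) (herr m hm)
    _ ≤ (2 : ℝ) ^ (-(n * condEntropy P W) + δ) *
          (2 : ℝ) ^ (∑ _k : Fin n, entropy (avgState P W) + δ) := by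
        rw [← Finset.mul_sum]
        gcongr
        exact h2.trans (trace_typProj_le _ _)
    _ = (2 : ℝ) ^ (n * mutualInfo P W + 2 * δ) := by
        rw [← Real.rpow_add two_pos, mutualInfo]
        congr 1
        simp only [Finset.sum_const, Finset.card_univ, Fintype.card_fin, nsmul_eq_mul]
        ring

open Classical in
/-- The number of occurrences of each letter in a word. -/
def letterCount (x : Fin n → X) (a : X) : Fin (n + 1) :=
  ⟨(Finset.univ.filter fun k => x k = a).card, by
    simpa [Nat.lt_succ_iff] using Finset.card_le_univ (Finset.univ.filter fun k => x k = a)⟩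

theorem sum_eq_sum_letterCount (x : Fin n → X) (g : X → ℝ) :
    ∑ k, g (x k) = ∑ a, (letterCount x a : ℝ) * g a := by
  classical
  rw [← Finset.sum_fiberwise Finset.univ x fun k => g (x k)]
  refine Finset.sum_congr rfl fun a _ => ?_
  rw [Finset.sum_congr rfl fun k hk => by rw [(Finset.mem_filter.mp hk).2]]
  simp only [Finset.sum_const, nsmul_eq_mul, letterCount]

/-- Every nonempty word has a type, determined by its letter counts. -/
theorem exists_hasType (hn : 1 ≤ n) (x : Fin n → X) :
    ∃ P : stdSimplex ℝ X, ∀ y : Fin n → X, letterCount y = letterCount x → HasType P y := by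
  have hn0 : (n : ℝ) ≠ 0 := by positivity
  refine ⟨⟨fun a => (letterCount x a : ℝ) / n, fun a => by positivity, ?_⟩, fun y hy g => ?_⟩
  · rw [← Finset.sum_div, div_eq_one_iff_eq hn0]
    have := sum_eq_sum_letterCount x fun _ => 1
    simpa using this.symm
  · rw [sum_eq_sum_letterCount, hy, Finset.mul_sum]
    refine Finset.sum_congr rfl fun a _ => ?_
    change _ = (n : ℝ) * ((letterCount x a : ℝ) / n * g a)
    field_simp

/-- The strong converse, up to the choice of constants: a code splits into at most
`(n + 1) ^ |X|` subcodes of constant type. -/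
theorem card_le_of_forall_mutualInfo_le {α : Type*} (s : Finset α) (hn : 1 ≤ n)
    (W : Channel X ι) {C δ lam : ℝ} (hC : ∀ P, mutualInfo P W ≤ C) (hδ : 0 < δ) (hlam : lam < 1)
    (hδl : n * (9 * Fintype.card ι) / δ ^ 2 ≤ (1 - lam) / 8)
    (x : α → Fin n → X) (D : α → Matrix (Fin n → ι) (Fin n → ι) ℂ)
    (hD : ∀ m, (D m).PosSemidef) (hDs : (1 - ∑ m ∈ s, D m).PosSemidef)
    (herr : ∀ m ∈ s, 1 - lam ≤ tracePair (outputMat W (x m)) (D m)) :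
    (s.card : ℝ) ≤ (n + 1) ^ Fintype.card X * (4 / (1 - lam) * (2 : ℝ) ^ (n * C + 2 * δ)) := by
  classical
  have h1l : 0 < 1 - lam := by linarith
  rw [Finset.card_eq_sum_card_fiberwise (f := fun m => letterCount (x m)) (t := Finset.univ)
    fun _ _ => Finset.mem_univ _]
  push_cast
  refine (Finset.sum_le_card_nsmul _ _ (4 / (1 - lam) * (2 : ℝ) ^ (n * C + 2 * δ))
    fun T _ => ?_).trans (by simp)
  set t := s.filter fun m => letterCount (x m) = T with ht
  rcases t.eq_empty_or_nonempty with h0 | ⟨m₀, hm₀⟩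
  · rw [h0]
    simp only [Finset.card_empty, Nat.cast_zero]
    positivity
  obtain ⟨P, hP⟩ := exists_hasType hn (x m₀)
  have hts : t ⊆ s := Finset.filter_subset _ _
  have hDt : (1 - ∑ m ∈ t, D m).PosSemidef := by
    have := hDs.add (posSemidef_sum (s \ t) fun i _ => hD i)
    rw [← Finset.sum_sdiff hts] at this
    convert this using 1
    abel
  have h := card_le_of_hasType t P W hδ hδl x D
    (fun m hm => hP _ ((Finset.mem_filter.mp hm).2.trans (Finset.mem_filter.mp hm₀).2.symm)) hD
    hDt fun m hm => herr m (hts hm)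
  have hmono : (2 : ℝ) ^ (n * mutualInfo P W + 2 * δ) ≤ (2 : ℝ) ^ (n * C + 2 * δ) := by
    gcongr
    · norm_num
    · exact hC P
  rw [div_mul_eq_mul_div, le_div_iff₀ h1l]
  linarith

end Converse

/-! ### The direct part -/

section Direct

theorem one_sub_sub_conj_posSemidef {κ : Type*} [Fintype κ] [DecidableEq κ]
    {B Q : Matrix κ κ ℂ} (hB : B.PosSemidef) (hB1 : (1 - B).PosSemidef)
    (hQ1 : (1 - Q).PosSemidef) : (1 - B - (1 - B) * Q * (1 - B)).PosSemidef := by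
  have h1 : (1 - (1 - B)).PosSemidef := by simpa using hB
  have h := (posSemidef_sub_sq hB1 h1).add (hQ1.conj_isHermitian hB1.1)
  convert h using 1
  noncomm_ring

/-- If the state `ρ` passes the test `Q` with probability close to `1` and is hardly detected by
`B`, then it also passes the test `(1 - B) Q (1 - B)`, which is compatible with `B`. -/
theorem le_tracePair_conj_one_sub {κ : Type*} [Fintype κ] [DecidableEq κ]
    {ρ B Q : Matrix κ κ ℂ} (hρ : ρ.PosSemidef) (hρ1 : tracePair ρ 1 = 1) (hB : B.PosSemidef)
    (hB1 : (1 - B).PosSemidef) (hQ : Q.PosSemidef) (hQ1 : (1 - Q).PosSemidef) {lam : ℝ}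
    (h0 : 0 < lam) (h1 : lam < 1) (hρQ : tracePair ρ (1 - Q) ≤ lam / 3)
    (hρB : tracePair ρ B < lam ^ 2 / 12) :
    1 - lam ≤ tracePair ρ ((1 - B) * Q * (1 - B)) := by
  have h2 := tracePair_mono_right hρ
    (posSemidef_pinching hB1.1 hQ (show (0 : ℝ) < lam / 3 by positivity))
  rw [tracePair_add_right, tracePair_smul_right, tracePair_smul_right, sub_sub_cancel] at h2
  have h3 : tracePair ρ (B * Q * B) ≤ tracePair ρ B := by
    refine tracePair_mono_right hρ ?_
    have h := (posSemidef_sub_sq hB hB1).add (hQ1.conj_isHermitian hB.1)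
    convert h using 1
    noncomm_ring
  rw [tracePair_sub_right, hρ1] at hρQ
  set u := tracePair ρ ((1 - B) * Q * (1 - B))
  have h4 : (1 + (lam / 3)⁻¹) * tracePair ρ (B * Q * B) ≤ lam / 3 := by
    calc _ ≤ (1 + (lam / 3)⁻¹) * (lam ^ 2 / 12) := by
          gcongr
          linarith
      _ = lam * (lam + 3) / 12 := by field_simp
      _ ≤ lam / 3 := by nlinarith
  have h5 : 1 - 2 * lam / 3 ≤ (1 + lam / 3) * u := by linarith
  by_contra hu
  push Not at hu
  nlinarith

variable {X ι : Type*} [Fintype ι] {n : ℕ}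

theorem avgState_tens_eq [Fintype X] (P : stdSimplex ℝ X) (W : Channel X ι) :
    tens (fun _ : Fin n => (avgState P W).mat) =
      ∑ x : Fin n → X, ((∏ k, P (x k) : ℝ) : ℂ) • outputMat W x := by
  classical
  ext i j
  simp only [tens, avgState, of_apply, Matrix.sum_apply, Matrix.smul_apply, smul_eq_mul,
    outputMat, Complex.ofReal_prod, ← Finset.prod_mul_distrib]
  rw [Finset.prod_univ_sum, Fintype.piFinset_univ]

variable [DecidableEq ι]

theorem BlockCode.errorProb_le_iff (c : BlockCode X ι n) (W : Channel X ι) {lam : ℝ}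
    (hlam : 0 ≤ lam) : c.errorProb W ≤ lam ↔
      ∀ m : c.messages, 1 - lam ≤ tracePair (outputMat W (c.encode m)) (c.D m) := by
  have hb : BddAbove (Set.range fun m : c.messages =>
      (1 - (Matrix.trace (outputMat W (c.encode m) * c.D m)).re)) := Set.finite_range _ |>.bddAbove
  constructor
  · intro h m
    have := (le_ciSup hb m).trans h
    simp only [tracePair]
    linarith
  · intro h
    refine Real.iSup_le (fun m => ?_) hlam
    have := h m
    simp only [tracePair] at this
    linarith

/-- A subnormalized code of size `N` with codewords `x` and decoding operators `D` of trace at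
most `R`, recognizing their codewords with probability at least `1 - lam`. -/
def IsPartialCode (W : Channel X ι) (n : ℕ) (lam R : ℝ) (N : ℕ) : Prop :=
  ∃ (x : Fin N → Fin n → X) (D : Fin N → Matrix (Fin n → ι) (Fin n → ι) ℂ),
    (∀ i, (D i).PosSemidef) ∧ (1 - ∑ i, D i).PosSemidef ∧
      ∀ i, 1 - lam ≤ tracePair (outputMat W (x i)) (D i) ∧ tracePair 1 (D i) ≤ R

/-- A subnormalized code is completed to a code by an outcome which is not a message. -/
theorem IsPartialCode.mem_codeSizes {W : Channel X ι} {lam R : ℝ} {N : ℕ} (hlam : 0 ≤ lam)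
    (h : IsPartialCode W n lam R N) : N ∈ codeSizes W n lam := by
  classical
  obtain ⟨x, D, hD, hD1, herr⟩ := h
  have hmem : ∀ m : (Finset.univ.map Function.Embedding.some : Finset (Option (Fin N))),
      ∃ i, some i = m.1 := fun m => by
    obtain ⟨i, -, hi⟩ := Finset.mem_map.mp m.2
    exact ⟨i, hi⟩
  choose idx hidx using hmem
  refine ⟨{ Outcome := Option (Fin N)
            D := fun o => o.elim (1 - ∑ i, D i) D
            D_posSemidef := fun o => by cases o <;> simp [hD, hD1]
            D_sum := by simp [Fintype.sum_option]
            messages := Finset.univ.map Function.Embedding.some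
            encode := fun m => x (idx m) }, ?_, by simp [BlockCode.size]⟩
  rw [BlockCode.errorProb_le_iff _ _ hlam]
  intro m
  change 1 - lam ≤ tracePair (outputMat W (x (idx m))) (Option.elim m.1 (1 - ∑ i, D i) D)
  rw [← hidx m]
  exact (herr (idx m)).1

/-- Maximal codes cannot be extended: if no subnormalized code is longer than `N`, the total
decoding operator `B` of some code of size `N` detects every word `x` for which the dimension
bound of the typical projection is at most `R`. -/
theorem exists_detecting_effect (W : Channel X ι) {lam R δ : ℝ} (h0 : 0 < lam) (h1 : lam < 1)
    (hδ : 0 < δ) (hδl : n * (9 * Fintype.card ι) / δ ^ 2 ≤ lam / 3) {N : ℕ}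
    (hN : IsPartialCode W n lam R N) (hmax : ¬ IsPartialCode W n lam R (N + 1)) :
    ∃ B : Matrix (Fin n → ι) (Fin n → ι) ℂ, B.PosSemidef ∧ (1 - B).PosSemidef ∧
      tracePair 1 B ≤ N * R ∧ ∀ x : Fin n → X,
        (2 : ℝ) ^ (∑ k, entropy (W (x k)) + δ) ≤ R →
          lam ^ 2 / 12 ≤ tracePair (outputMat W x) B := by
  obtain ⟨x, D, hD, hD1, herr⟩ := hN
  have hB : (∑ i, D i).PosSemidef := posSemidef_sum _ fun i _ => hD i
  refine ⟨∑ i, D i, hB, hD1, ?_, fun y hy => ?_⟩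
  · rw [tracePair_sum_right]
    exact (Finset.sum_le_card_nsmul _ _ R fun i _ => (herr i).2).trans (by simp)
  by_contra hcon
  push Not at hcon
  refine hmax ?_
  generalize hBdef : ∑ i, D i = B at hB hD1 hcon
  set Q := typProj (fun k => W (y k)) δ with hQ
  have hQ0 : Q.PosSemidef := typProj_posSemidef _ _
  have hQ1 : (1 - Q).PosSemidef := one_sub_typProj_posSemidef _ _
  have hpos : ((1 - B) * Q * (1 - B)).PosSemidef := hQ0.conj_isHermitian hD1.1
  have hsum : (1 - ((1 - B) * Q * (1 - B) + B)).PosSemidef := by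
    have := one_sub_sub_conj_posSemidef hB hD1 hQ1
    rwa [sub_sub, add_comm B] at this
  have hacc : 1 - lam ≤ tracePair (outputMat W y) ((1 - B) * Q * (1 - B)) :=
    le_tracePair_conj_one_sub (tens_state_posSemidef fun k => W (y k))
      (tracePair_tens_state_one fun k => W (y k)) hB hD1 hQ0 hQ1 h0 h1
      ((tracePair_self_one_sub_typProj_le (fun k => W (y k)) hδ).trans hδl) hcon
  have htr : tracePair 1 ((1 - B) * Q * (1 - B)) ≤ R := by
    rw [tracePair_conj, mul_one]
    refine (tracePair_mono_left hQ0 ?_).trans ((trace_typProj_le _ _).trans hy)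
    have h := (posSemidef_sub_sq hD1 (by simpa using hB)).add hB
    convert h using 1
    abel
  refine ⟨Fin.cons y x, Fin.cons ((1 - B) * Q * (1 - B)) D, fun i => ?_, ?_, fun i => ?_⟩
  · cases i using Fin.cases with
    | zero => exact hpos
    | succ i => exact hD i
  · rw [Fin.sum_univ_succ]
    simp only [Fin.cons_zero, Fin.cons_succ, hBdef]
    exact hsum
  · cases i using Fin.cases with
    | zero => exact ⟨hacc, htr⟩
    | succ i => exact herr i

/-- The direct coding theorem, up to the choice of constants. -/
theorem le_maxCodeSize [Fintype X] (W : Channel X ι) (P : stdSimplex ℝ X) {lam δ δ' : ℝ}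
    (h0 : 0 < lam) (h1 : lam < 1) (hδ : 0 < δ) (hδ' : 0 < δ')
    (hδl : n * (9 * Fintype.card ι) / δ ^ 2 ≤ lam ^ 2 / 48)
    (hδl' : n * (9 * Fintype.card ι) ^ 2 / δ' ^ 2 ≤ 1 / 2)
    (hb : BddAbove (codeSizes W n lam)) :
    lam ^ 2 / 48 * (2 : ℝ) ^ (n * mutualInfo P W - (2 * δ + δ')) ≤ maxCodeSize W n lam := by
  classical
  set R : ℝ := (2 : ℝ) ^ (n * condEntropy P W + δ' + δ) with hR
  have hsub : {N | IsPartialCode W n lam R N} ⊆ codeSizes W n lam :=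
    fun N hN => hN.mem_codeSizes h0.le
  have hne : {N | IsPartialCode W n lam R N}.Nonempty := by
    refine ⟨0, Fin.elim0, Fin.elim0, fun i => i.elim0, ?_, fun i => i.elim0⟩
    simpa using PosSemidef.one
  have hbdd := hb.mono hsub
  set N := sSup {N | IsPartialCode W n lam R N} with hNdef
  have hN : IsPartialCode W n lam R N := Nat.sSup_mem hne hbdd
  have hmax : ¬ IsPartialCode W n lam R (N + 1) := fun h => by
    have := le_csSup hbdd h
    omega
  obtain ⟨B, hB, hB1, hBR, hdet⟩ := exists_detecting_effect W h0 h1 hδ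
    (hδl.trans (by nlinarith)) hN hmax
  -- the words whose conditional entropy is not much larger than its mean have probability `≥ 1/2`
  set p : (Fin n → X) → ℝ := fun x => ∏ k, P (x k) with hp
  have hp0 : ∀ x, 0 ≤ p x := fun x => Finset.prod_nonneg fun k _ => P.2.1 _
  have hp1 : ∑ x, p x = 1 := sum_prod_eq_one (q := fun _ : Fin n => P) fun _ => P.2.2
  set A := Finset.univ.filter fun x : Fin n → X =>
    ∑ k, entropy (W (x k)) ≤ n * condEntropy P W + δ' with hA
  have hAc : ∑ x ∈ Aᶜ, p x ≤ 1 / 2 := by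
    refine (chebyshev_prod (q := fun _ : Fin n => P) (f := fun _ a => entropy (W a))
      (M := n * condEntropy P W) (V := n * (9 * Fintype.card ι) ^ 2) (fun _ => P.2.1)
      (fun _ => P.2.2) ?_ ?_ hδ' Aᶜ fun x hx => ?_).trans hδl'
    · simp [condEntropy]
    · refine (Finset.sum_le_card_nsmul _ _ ((9 * Fintype.card ι : ℝ) ^ 2) fun k _ => ?_).trans
        (by simp)
      calc ∑ a, P a * entropy (W a) ^ 2
          ≤ ∑ a, P a * (9 * Fintype.card ι : ℝ) ^ 2 := by
            refine Finset.sum_le_sum fun a _ => mul_le_mul_of_nonneg_left ?_ (P.2.1 a)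
            exact pow_le_pow_left₀ (entropy_nonneg _) (entropy_le _) 2
        _ = (9 * Fintype.card ι : ℝ) ^ 2 := by
            rw [← Finset.sum_mul]
            exact (congrArg (· * _) P.2.2).trans (one_mul _)
    · simp only [hA, Finset.compl_filter, Finset.mem_filter, not_le] at hx
      rw [le_abs]
      left
      linarith [hx.2]
  have hAp : 1 / 2 ≤ ∑ x ∈ A, p x := by
    have := Finset.sum_add_sum_compl A p
    rw [hp1] at this
    linarith
  have hlow : lam ^ 2 / 24 ≤ tracePair (tens fun _ : Fin n => (avgState P W).mat) B := by
    rw [avgState_tens_eq, tracePair_sum_left]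
    simp only [tracePair_smul_left]
    calc lam ^ 2 / 24 ≤ (∑ x ∈ A, p x) * (lam ^ 2 / 12) := by nlinarith [sq_nonneg lam]
      _ ≤ ∑ x ∈ A, p x * tracePair (outputMat W x) B := by
          rw [Finset.sum_mul]
          refine Finset.sum_le_sum fun x hx => mul_le_mul_of_nonneg_left (hdet x ?_) (hp0 x)
          have := (Finset.mem_filter.mp hx).2
          rw [hR, Real.rpow_le_rpow_left_iff one_lt_two]
          linarith
      _ ≤ ∑ x, p x * tracePair (outputMat W x) B :=
          Finset.sum_le_sum_of_subset_of_nonneg (Finset.subset_univ A) fun x _ _ =>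
            mul_nonneg (hp0 x) (tracePair_nonneg (tens_state_posSemidef fun k => W (x k)) hB)
  have hup := tracePair_tens_le (fun _ : Fin n => avgState P W) hδ hB hB1
  simp only [Finset.sum_const, Finset.card_univ, Fintype.card_fin, nsmul_eq_mul] at hup
  have hmain : lam ^ 2 / 48 ≤ (2 : ℝ) ^ (-(n * entropy (avgState P W)) + δ) * (N * R) := by
    have : (2 : ℝ) ^ (-(n * entropy (avgState P W)) + δ) * tracePair 1 B ≤
        (2 : ℝ) ^ (-(n * entropy (avgState P W)) + δ) * (N * R) := by gcongr
    linarith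
  have hexp : (2 : ℝ) ^ (-(n * entropy (avgState P W)) + δ) * (N * R) *
      (2 : ℝ) ^ (n * mutualInfo P W - (2 * δ + δ')) = N := by
    have : (2 : ℝ) ^ (-(n * entropy (avgState P W)) + δ) * R *
        (2 : ℝ) ^ (n * mutualInfo P W - (2 * δ + δ')) = 1 := by
      rw [hR, ← Real.rpow_add two_pos, ← Real.rpow_add two_pos, mutualInfo]
      ring_nf
      simp
    calc _ = N * ((2 : ℝ) ^ (-(n * entropy (avgState P W)) + δ) * R *
          (2 : ℝ) ^ (n * mutualInfo P W - (2 * δ + δ'))) := by ring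
      _ = N := by rw [this, mul_one]
  calc lam ^ 2 / 48 * (2 : ℝ) ^ (n * mutualInfo P W - (2 * δ + δ'))
      ≤ (2 : ℝ) ^ (-(n * entropy (avgState P W)) + δ) * (N * R) *
          (2 : ℝ) ^ (n * mutualInfo P W - (2 * δ + δ')) := by gcongr
    _ = N := hexp
    _ ≤ maxCodeSize W n lam := by exact_mod_cast le_csSup hb (hsub hN)

end Direct

/-! ### Attainment of the capacity, and the constants -/

section Capacity

variable {X ι : Type*} [Fintype X] [Fintype ι] [DecidableEq ι]

theorem continuous_neg_mul_logb : Continuous fun x : ℝ => -(x * Real.logb 2 x) := by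
  have : (fun x : ℝ => -(x * Real.logb 2 x)) = fun x => Real.negMulLog x / Real.log 2 := by
    ext x
    simp only [Real.negMulLog, Real.logb]
    ring
  rw [this]
  exact Real.continuous_negMulLog.div_const _

theorem entropy_eq_trace_cfc (ρ : State ι) :
    entropy ρ = (trace (cfc (fun x : ℝ => -(x * Real.logb 2 x)) ρ.mat)).re := by
  rw [ρ.posSemidef.isHermitian.cfc_eq, IsHermitian.cfc, Unitary.conjStarAlgAut_apply]
  have h := trace_specMat ρ.eigU_unitary fun j => -(ρ.eig j * Real.logb 2 (ρ.eig j))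
  rw [entropy_eq]
  simp only [mul_neg]
  exact h.symm

open scoped Matrix.Norms.L2Operator in
theorem continuous_entropy_avgState (W : Channel X ι) :
    Continuous fun P : stdSimplex ℝ X => entropy (avgState P W) := by
  simp only [entropy_eq_trace_cfc]
  refine Complex.continuous_re.comp (Continuous.matrix_trace ?_)
  refine Continuous.cfc' (isCompact_Icc (a := (0 : ℝ)) (b := 1)) _ ?_ (fun P => ?_)
    continuous_neg_mul_logb.continuousOn fun P => (avgState P W).posSemidef.isHermitian
  · simp only [avgState]
    refine continuous_finsetSum _ fun x _ => ?_
    have hx : Continuous fun P : stdSimplex ℝ X => ((P x : ℝ) : ℂ) :=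
      Complex.continuous_ofReal.comp ((continuous_apply x).comp continuous_subtype_val)
    exact hx.smul continuous_const
  · rw [(avgState P W).posSemidef.isHermitian.spectrum_real_eq_range_eigenvalues]
    rintro _ ⟨j, rfl⟩
    exact ⟨(avgState P W).eig_nonneg j, (avgState P W).eig_le_one j⟩

/-- The mutual information is continuous on the compact simplex, so its maximum is attained. -/
theorem isGreatest_capacity [Nonempty X] (W : Channel X ι) :
    IsGreatest (Set.range fun P : stdSimplex ℝ X => mutualInfo P W) (capacity W) := by
  classical
  have hcont : Continuous fun P : stdSimplex ℝ X => mutualInfo P W := by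
    refine (continuous_entropy_avgState W).sub (continuous_finsetSum _ fun x _ => ?_)
    exact ((continuous_apply x).comp continuous_subtype_val).mul continuous_const
  have : CompactSpace (stdSimplex ℝ X) :=
    isCompact_iff_compactSpace.mp (isCompact_stdSimplex ℝ X)
  have : Nonempty (stdSimplex ℝ X) :=
    ⟨⟨_, single_mem_stdSimplex ℝ (Classical.arbitrary X)⟩⟩
  exact (isCompact_range hcont).isGreatest_sSup (Set.range_nonempty _)

/-- The strong converse for codes in the sense of `BlockCode`. -/
theorem le_of_mem_codeSizes {n : ℕ} (hn : 1 ≤ n) (W : Channel X ι) {C δ lam : ℝ}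
    (hC : ∀ P, mutualInfo P W ≤ C) (hδ : 0 < δ) (h0 : 0 ≤ lam) (hlam : lam < 1)
    (hδl : n * (9 * Fintype.card ι) / δ ^ 2 ≤ (1 - lam) / 8) {N : ℕ}
    (hN : N ∈ codeSizes W n lam) :
    (N : ℝ) ≤ (n + 1) ^ Fintype.card X * (4 / (1 - lam) * (2 : ℝ) ^ (n * C + 2 * δ)) := by
  classical
  obtain ⟨c, hc, rfl⟩ := hN
  let _ := c.fintypeOutcome
  have h := card_le_of_forall_mutualInfo_le (Finset.univ : Finset c.messages) hn W hC hδ hlam hδl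
    c.encode (fun m => c.D m) (fun m => c.D_posSemidef m) ?_
    fun m _ => (c.errorProb_le_iff W h0).mp hc m
  · simpa [BlockCode.size] using h
  · rw [Finset.sum_coe_sort c.messages c.D, ← c.D_sum, ← Finset.sum_add_sum_compl c.messages c.D,
      add_sub_cancel_left]
    exact posSemidef_sum _ fun i _ => c.D_posSemidef i

end Capacity

theorem logb_succ_le (n : ℕ) : Real.logb 2 (n + 1) ≤ 3 * √(n : ℝ) := by
  have hs : 0 ≤ √(n : ℝ) := Real.sqrt_nonneg _
  have hsq : √(n : ℝ) ^ 2 = n := Real.sq_sqrt (Nat.cast_nonneg n)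
  have h1 : Real.log (n + 1) ≤ 2 * √(n : ℝ) := by
    calc Real.log (n + 1) ≤ Real.log ((√(n : ℝ) + 1) ^ 2) :=
          Real.log_le_log (by positivity) (by nlinarith)
      _ = 2 * Real.log (√(n : ℝ) + 1) := by rw [Real.log_pow]; norm_num
      _ ≤ 2 * √(n : ℝ) := by
          have := Real.log_le_sub_one_of_pos (show 0 < √(n : ℝ) + 1 by positivity)
          linarith
  have h2 : (0.6931471803 : ℝ) < Real.log 2 := Real.log_two_gt_d9
  rw [Real.logb, div_le_iff₀ (by linarith)]
  nlinarith

theorem exists_pos_div_sq_le (V : ℝ) {ε : ℝ} (hε : 0 < ε) : ∃ κ : ℝ, 0 < κ ∧ V / κ ^ 2 ≤ ε := by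
  have h : Filter.Tendsto (fun κ : ℝ => V / κ ^ 2) Filter.atTop (nhds 0) :=
    Filter.Tendsto.const_div_atTop (Filter.tendsto_pow_atTop two_ne_zero) V
  exact ((Filter.eventually_gt_atTop 0).and (h.eventually (ge_mem_nhds hε))).exists

end CQ

end

theorem mainTheorem1 :
    ∀ lam : ℝ, 0 < lam → lam < 1 → ∀ a d : ℕ, ∃ K : ℝ,
      ∀ (X : Type*) [Fintype X] [Nonempty X] (ι : Type*) [Fintype ι] [DecidableEq ι],
        Fintype.card X = a → Fintype.card ι = d →
        ∀ W : CQ.Channel X ι,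
          IsGreatest (Set.range fun P : stdSimplex ℝ X => CQ.mutualInfo P W) (CQ.capacity W) ∧
          ∀ n : ℕ, 1 ≤ n →
            IsGreatest (CQ.codeSizes W n lam) (CQ.maxCodeSize W n lam) ∧
            |Real.logb 2 (CQ.maxCodeSize W n lam) - n * CQ.capacity W| ≤ K * √(n : ℝ) := by
  intro lam h0 h1 a d
  have h1' : 0 < 1 - lam := by linarith
  -- typicality windows of width `κ √n` have failure probability bounded uniformly in `n`
  obtain ⟨κ, hκ, hκε⟩ := CQ.exists_pos_div_sq_le (9 * d)
    (show 0 < min ((1 - lam) / 8) (lam ^ 2 / 48) by positivity)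
  obtain ⟨κ', hκ', hκε'⟩ := CQ.exists_pos_div_sq_le ((9 * d) ^ 2)
    (show (0 : ℝ) < 1 / 2 by norm_num)
  refine ⟨3 * a + |Real.logb 2 (4 / (1 - lam))| + |Real.logb 2 (lam ^ 2 / 48)| + 2 * κ + κ',
    fun X _ _ ι _ _ hX hι W => ⟨CQ.isGreatest_capacity W, fun n hn => ?_⟩⟩
  have hn1 : (1 : ℝ) ≤ √(n : ℝ) := Real.one_le_sqrt.mpr (by exact_mod_cast hn)
  have hn0 : (0 : ℝ) < n := by exact_mod_cast hn
  have hscale : ∀ V c : ℝ, n * V / (c * √(n : ℝ)) ^ 2 = V / c ^ 2 := fun V c => by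
    rw [mul_pow, Real.sq_sqrt hn0.le, mul_comm (n : ℝ) V, mul_div_mul_right _ _ hn0.ne']
  have hδ : 0 < κ * √(n : ℝ) := by positivity
  have hδ' : 0 < κ' * √(n : ℝ) := by positivity
  have hcap : ∀ P, CQ.mutualInfo P W ≤ CQ.capacity W :=
    fun P => (CQ.isGreatest_capacity W).2 ⟨P, rfl⟩
  have hup : ∀ N ∈ CQ.codeSizes W n lam, (N : ℝ) ≤ (n + 1) ^ a * (4 / (1 - lam) *
      (2 : ℝ) ^ (n * CQ.capacity W + 2 * (κ * √(n : ℝ)))) := fun N hN => by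
    rw [← hX]
    refine CQ.le_of_mem_codeSizes hn W hcap hδ h0.le h1 ?_ hN
    rw [hscale, hι]
    exact hκε.trans (min_le_left _ _)
  have hb : BddAbove (CQ.codeSizes W n lam) :=
    ⟨_, fun N hN => Nat.le_floor (hup N hN)⟩
  obtain ⟨P, hP⟩ := (CQ.isGreatest_capacity W).1
  have hlow := CQ.le_maxCodeSize W P h0 h1 hδ hδ' (n := n)
    (by rw [hscale, hι]; exact hκε.trans (min_le_right _ _)) (by rw [hscale, hι]; exact hκε') hb
  simp only at hP
  rw [hP] at hlow
  have hNpos : (0 : ℝ) < CQ.maxCodeSize W n lam := lt_of_lt_of_le (by positivity) hlow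
  have hmem : CQ.maxCodeSize W n lam ∈ CQ.codeSizes W n lam := by
    refine Nat.sSup_mem (Set.nonempty_iff_ne_empty.mpr fun h => ?_) hb
    rw [CQ.maxCodeSize, h, csSup_empty] at hNpos
    simp at hNpos
  refine ⟨⟨hmem, fun N hN => le_csSup hb hN⟩, ?_⟩
  have hlog1 := Real.logb_le_logb_of_le one_lt_two (by positivity) hlow
  rw [Real.logb_mul (by positivity) (by positivity), Real.logb_rpow two_pos (by norm_num)]
    at hlog1
  have hlog2 := Real.logb_le_logb_of_le one_lt_two hNpos (hup _ hmem)
  rw [Real.logb_mul (by positivity) (by positivity), Real.logb_mul (by positivity) (by positivity),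
    Real.logb_rpow two_pos (by norm_num), Real.logb_pow] at hlog2
  have e1 : (a : ℝ) * Real.logb 2 (n + 1) ≤ 3 * a * √(n : ℝ) := by
    have := mul_le_mul_of_nonneg_left (CQ.logb_succ_le n) (Nat.cast_nonneg (α := ℝ) a)
    linarith
  have e2 : Real.logb 2 (4 / (1 - lam)) ≤ |Real.logb 2 (4 / (1 - lam))| * √(n : ℝ) :=
    (le_abs_self _).trans (le_mul_of_one_le_right (abs_nonneg _) hn1)
  have e3 : -Real.logb 2 (lam ^ 2 / 48) ≤ |Real.logb 2 (lam ^ 2 / 48)| * √(n : ℝ) :=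
    (neg_le_abs _).trans (le_mul_of_one_le_right (abs_nonneg _) hn1)
  have f1 : 0 ≤ 3 * (a : ℝ) * √(n : ℝ) := by positivity
  have f2 : 0 ≤ |Real.logb 2 (4 / (1 - lam))| * √(n : ℝ) := by positivity
  have f3 : 0 ≤ |Real.logb 2 (lam ^ 2 / 48)| * √(n : ℝ) := by positivity
  rw [abs_le]
  constructor <;> linarith
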